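/- Let $\mu$ and $\nu$ be finite positive Borel measures on $\mathbb{R}$ such that $\int e^{\delta|x|}\,d\mu(x)<\infty$ and $\int e^{\delta|y|}\,d\nu(y)<\infty$ for some $\delta>0$. Let $(\alpha_n)_{n\ge 0}$ and $(\beta_n)_{n\ge 0}$ be real polynomials with $\deg\alpha_n=\deg\beta_n=n$ that are orthonormal with respect to $\mu$ and $\nu$ respectively, and write $$\alpha_n(x)=\sum_{j=0}^n a_{n,j}x^j,\qquad \beta_n(y)=\sum_{j=0}^n b_{n,j}y^j .$$ Let $(c_n)_{n\ge0}$ be a sequence of real numbers. Then the following two statements are equivalent. (i) The series $\sum_{n\ge0}c_n\alpha_n(x)\beta_n(y)$ converges in mean square, i.e. in $L^2(\mu\times\nu)$, to a function that is nonnegative $\mu\times\nu$-almost everywhere. (ii) $\sum_{n\ge0}c_n^2<\infty$, and there are two sequences of real polynomials $(m^{(a)}_n)_{n\ge0}$ and $(m^{(b)}_n)_{n\ge0}$ such that - for $\nu$-almost every $y$ there is a positive measure $\zeta_y\ll\mu$, all of whose moments exist, with $m^{(a)}_n(y)=\int x^n\,d\zeta_y(x)$ for all $n\ge 0$; - for $\mu$-almost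 every $x$ there is a positive measure $\chi_x\ll\nu$, all of whose moments exist, with $m^{(b)}_n(x)=\int y^n\,d\chi_x(y)$ for all $n\ge 0$; - for $\nu$-almost every $y$ and all $n\ge0$, $\ \sum_{j=0}^n a_{n,j}\,m^{(a)}_j(y)=c_n\beta_n(y)$; - for $\mu$-almost every $x$ and all $n\ge0$, $\ \sum_{j=0}^n b_{n,j}\,m^{(b)}_j(x)=c_n\alpha_n(x)$. -/

import Mathlib

open MeasureTheory Filter Topology Polynomial

/-- `μ` has a finite exponential moment: `∫ exp (δ|x|) dμ(x) < ∞` for some `δ > 0`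
(so that `μ` is identified by its moments). -/
def HasExpMoment (μ : Measure ℝ) : Prop :=
  ∃ δ : ℝ, 0 < δ ∧ Integrable (fun x : ℝ => Real.exp (δ * |x|)) μ

/-- `p 0, p 1, …` are polynomials with `deg (p n) = n`, orthonormal with respect to `μ`.
(The case `m = n` forces every `(p n)²`, hence every product, to be integrable.) -/
structure IsOrthonormalPolynomials (μ : Measure ℝ) (p : ℕ → ℝ[X]) : Prop where
  degree_eq : ∀ n : ℕ, (p n).degree = (n : WithBot ℕ)
  integral_mul : ∀ m n : ℕ,
    ∫ x, (p m).eval x * (p n).eval x ∂μ = if m = n then (1 : ℝ) else 0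

/-- The series `∑ c n * α n (x) * β n (y)` converges in mean square, i.e. in `L²(μ × ν)`,
to a function that is nonnegative almost everywhere. -/
def ConvergesToNonneg (μ ν : Measure ℝ) (α β : ℕ → ℝ[X]) (c : ℕ → ℝ) : Prop :=
  ∃ f : ℝ × ℝ → ℝ, MemLp f 2 (μ.prod ν) ∧ (∀ᵐ z ∂(μ.prod ν), 0 ≤ f z) ∧
    Tendsto
      (fun N : ℕ => eLpNorm
        (fun z : ℝ × ℝ =>
          (∑ n ∈ Finset.range N, c n * (α n).eval z.1 * (β n).eval z.2) - f z)
        2 (μ.prod ν))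
      atTop (𝓝 0)

/-- `m` is the moment sequence of the (positive) measure `ζ`: all moments exist and
`∫ x ^ n dζ(x) = m n`. -/
def IsMomentSequence (m : ℕ → ℝ) (ζ : Measure ℝ) : Prop :=
  ∀ n : ℕ, Integrable (fun x : ℝ => x ^ n) ζ ∧ ∫ x, x ^ n ∂ζ = m n

/-- The polynomials `m 0, m 1, …` form a polynomial moment sequence: there are positive measures
`ζ t` such that, for `ρ`-almost all `t`, `ζ t` is absolutely continuous with respect to `κ`
and has moment sequence `m 0 (t), m 1 (t), …`. -/
def IsPolynomialMomentFamily (κ ρ : Measure ℝ) (m : ℕ → ℝ[X]) : Prop :=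
  ∃ ζ : ℝ → Measure ℝ,
    ∀ᵐ t ∂ρ, ζ t ≪ κ ∧ IsMomentSequence (fun n => (m n).eval t) (ζ t)

/-! If `f` is the mean square sum, then for a.e. `x` the section `f (x, ·)` has coefficient `c n * α
n (x)` against `β n` (`ae_integral_eval_mul_section`). The `β n` form a basis of the polynomials, so
`∫ y ^ n * f (x, y) dν(y)` is the value at `x` of the image of `X ^ n` under the linear map `β n ↦ c
n • α n`, a polynomial in `x`. If `f ≥ 0`, these are the moments of the positive measure `f (x, ·)
dν`. The other variable is symmetric.

Conversely, the products `α n (x) * β n (y)` are orthonormal, so `∑ c n ^ 2 < ∞` yields a sum `f`,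
and the coefficient identities give the signed measure `f (x, ·) dν` the moments of the positive
measure `χ x`. With `F = f (x, ·)`, the positive measures `F⁺ dν` and `χ x + F⁻ dν` share all
moments. The first has exponential moments, hence they are equal
(`MeasureTheory.Measure.ext_of_moments_eq`); so `F⁻ ≤ F⁺`, that is `F ≥ 0`, almost everywhere. -/

/-! ### Moment determinacy under exponential integrability -/

/-- The integral of `cosh (t x)` is determined by the moments. -/
theorem lintegral_cosh_eq_tsum {ρ : Measure ℝ} (hρ : ∀ n : ℕ, Integrable (fun x : ℝ => x ^ n) ρ)
    (t : ℝ) :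
    ∫⁻ x, ENNReal.ofReal (Real.cosh (t * x)) ∂ρ =
      ∑' n : ℕ, ENNReal.ofReal (t ^ (2 * n) / (2 * n).factorial * ∫ x, x ^ (2 * n) ∂ρ) := by
  have hnonneg : ∀ (n : ℕ) (x : ℝ), 0 ≤ (t * x) ^ (2 * n) / ((2 * n).factorial : ℝ) := fun n x => by
    rw [pow_mul]; positivity
  have h : ∀ x : ℝ, ENNReal.ofReal (Real.cosh (t * x)) =
      ∑' n : ℕ, ENNReal.ofReal ((t * x) ^ (2 * n) / (2 * n).factorial) := fun x => by
    rw [← (Real.hasSum_cosh (t * x)).tsum_eq,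
      ENNReal.ofReal_tsum_of_nonneg (fun n => hnonneg n x) (Real.hasSum_cosh (t * x)).summable]
  simp_rw [h]
  rw [lintegral_tsum (fun n => by fun_prop)]
  refine tsum_congr fun n => ?_
  have e : ∀ x : ℝ, (t * x) ^ (2 * n) / ((2 * n).factorial : ℝ) =
      t ^ (2 * n) / (2 * n).factorial * x ^ (2 * n) := fun x => by rw [mul_pow]; ring
  rw [← integral_const_mul, ofReal_integral_eq_lintegral_ofReal ((hρ _).const_mul _)
    (ae_of_all _ fun x => (hnonneg n x).trans_eq (e x))]
  simp_rw [e]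

/-- The series of `cosh (t * x)` has only nonnegative terms, so its integral depends on the moments
alone, finite or not; and `exp ≤ 2 cosh`. Thus determinacy needs exponential integrability of one
measure only. -/
theorem mem_integrableExpSet_of_moments_eq {ρ σ : Measure ℝ}
    (hρ : ∀ n : ℕ, Integrable (fun x : ℝ => x ^ n) ρ)
    (hσ : ∀ n : ℕ, Integrable (fun x : ℝ => x ^ n) σ)
    (h : ∀ n : ℕ, ∫ x, x ^ n ∂ρ = ∫ x, x ^ n ∂σ) {t : ℝ}
    (ht : t ∈ ProbabilityTheory.integrableExpSet id ρ)
    (ht' : -t ∈ ProbabilityTheory.integrableExpSet id ρ) :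
    t ∈ ProbabilityTheory.integrableExpSet id σ := by
  have ht₁ : Integrable (fun x : ℝ => Real.exp (t * x)) ρ := ht
  have ht₂ : Integrable (fun x : ℝ => Real.exp (-(t * x))) ρ := by
    have : Integrable (fun x : ℝ => Real.exp (-t * x)) ρ := ht'
    simpa only [neg_mul] using this
  have hcosh : Integrable (fun x : ℝ => Real.cosh (t * x)) ρ := by
    simp_rw [Real.cosh_eq]
    exact (ht₁.add ht₂).div_const 2
  have hcoshσ : Integrable (fun x : ℝ => Real.cosh (t * x)) σ := by
    refine (lintegral_ofReal_ne_top_iff_integrable (by fun_prop)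
      (ae_of_all _ fun x => (Real.cosh_pos _).le)).1 ?_
    have := (lintegral_ofReal_ne_top_iff_integrable (by fun_prop)
      (ae_of_all _ fun x => (Real.cosh_pos _).le)).2 hcosh
    rw [lintegral_cosh_eq_tsum hρ] at this
    rw [lintegral_cosh_eq_tsum hσ]
    simpa only [h] using this
  change Integrable (fun x : ℝ => Real.exp (t * x)) σ
  refine (hcoshσ.const_mul 2).mono' (by fun_prop) (ae_of_all _ fun x => ?_)
  rw [Real.norm_eq_abs, Real.abs_exp, Real.cosh_eq]
  linarith [Real.exp_pos (-(t * x))]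

theorem zero_mem_interior_integrableExpSet_of_moments_eq {ρ σ : Measure ℝ}
    (hexp : 0 ∈ interior (ProbabilityTheory.integrableExpSet id ρ))
    (hσ : ∀ n : ℕ, Integrable (fun x : ℝ => x ^ n) σ)
    (h : ∀ n : ℕ, ∫ x, x ^ n ∂ρ = ∫ x, x ^ n ∂σ) :
    0 ∈ interior (ProbabilityTheory.integrableExpSet id σ) := by
  have hρ : ∀ n : ℕ, Integrable (fun x : ℝ => x ^ n) ρ := fun n => by
    simpa using ProbabilityTheory.integrable_pow_of_mem_interior_integrableExpSet hexp n
  rw [mem_interior_iff_mem_nhds] at hexp ⊢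
  have hneg : ∀ᶠ t : ℝ in 𝓝 0, -t ∈ ProbabilityTheory.integrableExpSet id ρ := by
    have : Tendsto (fun t : ℝ => -t) (𝓝 0) (𝓝 0) := by simpa using (continuous_neg (G := ℝ)).tendsto 0
    exact this.eventually hexp
  filter_upwards [hexp, hneg] with t h₁ h₂
  exact mem_integrableExpSet_of_moments_eq hρ hσ h h₁ h₂

/-- A finite measure on the line with exponential moments is determined by its moments. -/
theorem MeasureTheory.Measure.ext_of_moments_eq {ρ σ : Measure ℝ}
    [IsFiniteMeasure ρ] [IsFiniteMeasure σ]
    (hexp : 0 ∈ interior (ProbabilityTheory.integrableExpSet id ρ))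
    (hσ : ∀ n : ℕ, Integrable (fun x : ℝ => x ^ n) σ)
    (h : ∀ n : ℕ, ∫ x, x ^ n ∂ρ = ∫ x, x ^ n ∂σ) : ρ = σ := by
  have hexp' := zero_mem_interior_integrableExpSet_of_moments_eq hexp hσ h
  -- Both complex moment generating functions are analytic on the strip over `S`, which is convex
  -- and contains the imaginary axis, where they are the characteristic functions.
  set S : Set ℝ := interior (ProbabilityTheory.integrableExpSet id ρ) ∩
    interior (ProbabilityTheory.integrableExpSet id σ) with hS
  have hconv : Convex ℝ S :=
    ProbabilityTheory.convex_integrableExpSet.interior.inter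
      ProbabilityTheory.convex_integrableExpSet.interior
  have hpre : IsPreconnected {z : ℂ | z.re ∈ S} :=
    (hconv.linear_preimage Complex.reLm).isPreconnected
  -- Derivatives at `0` are the moments, so the Taylor series coincide.
  have hderiv : ∀ n : ℕ, iteratedDeriv n (ProbabilityTheory.complexMGF id ρ) 0 =
      iteratedDeriv n (ProbabilityTheory.complexMGF id σ) 0 := fun n => by
    rw [ProbabilityTheory.iteratedDeriv_complexMGF (by simpa using hexp),
      ProbabilityTheory.iteratedDeriv_complexMGF (by simpa using hexp')]
    have := congrArg (fun r : ℝ => (r : ℂ)) (h n)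
    simp only [← integral_complex_ofReal] at this
    simpa using this
  have hfps₁ := (ProbabilityTheory.analyticAt_complexMGF (X := id) (μ := ρ) (z := 0)
    (by simpa using hexp)).hasFPowerSeriesAt
  have hfps₂ := (ProbabilityTheory.analyticAt_complexMGF (X := id) (μ := σ) (z := 0)
    (by simpa using hexp')).hasFPowerSeriesAt
  simp_rw [hderiv] at hfps₁
  have hev : ProbabilityTheory.complexMGF id ρ =ᶠ[𝓝 0] ProbabilityTheory.complexMGF id σ := by
    obtain ⟨r₁, h₁⟩ := hfps₁
    obtain ⟨r₂, h₂⟩ := hfps₂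
    have h₁' := h₁.mono (lt_min h₁.r_pos h₂.r_pos) (min_le_left _ _)
    have h₂' := h₂.mono (lt_min h₁.r_pos h₂.r_pos) (min_le_right _ _)
    exact (h₁'.unique h₂').eventuallyEq_of_mem (Metric.eball_mem_nhds _ h₁'.r_pos)
  have hEq : Set.EqOn (ProbabilityTheory.complexMGF id ρ) (ProbabilityTheory.complexMGF id σ)
      {z : ℂ | z.re ∈ S} :=
    AnalyticOnNhd.eqOn_of_preconnected_of_eventuallyEq
      (ProbabilityTheory.analyticOnNhd_complexMGF.mono fun z hz => hz.1)
      (ProbabilityTheory.analyticOnNhd_complexMGF.mono fun z hz => hz.2)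
      hpre (z₀ := 0) (by simpa [hS] using ⟨hexp, hexp'⟩) hev
  refine Measure.ext_of_charFun (funext fun t => ?_)
  rw [← ProbabilityTheory.complexMGF_id_mul_I, ← ProbabilityTheory.complexMGF_id_mul_I]
  exact hEq (by simpa [hS] using ⟨hexp, hexp'⟩)

/-! ### Square integrable densities and their sign -/

theorem HasExpMoment.zero_mem_interior_integrableExpSet {μ : Measure ℝ} (h : HasExpMoment μ) :
    0 ∈ interior (ProbabilityTheory.integrableExpSet id μ) := by
  obtain ⟨δ, hδ, hint⟩ := h
  rw [mem_interior_iff_mem_nhds]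
  filter_upwards [Metric.ball_mem_nhds (0 : ℝ) hδ] with t ht
  have ht' : |t| ≤ δ := by
    rw [Metric.mem_ball, dist_zero_right, Real.norm_eq_abs] at ht
    exact ht.le
  change Integrable (fun x : ℝ => Real.exp (t * x)) μ
  refine hint.mono' (by fun_prop) (ae_of_all _ fun x => ?_)
  rw [Real.norm_eq_abs, Real.abs_exp, Real.exp_le_exp]
  calc t * x ≤ |t * x| := le_abs_self _
    _ = |t| * |x| := abs_mul _ _
    _ ≤ δ * |x| := by gcongr

theorem HasExpMoment.memLp_pow {μ : Measure ℝ} (h : HasExpMoment μ) (n : ℕ) :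
    MemLp (fun x : ℝ => x ^ n) 2 μ := by
  refine (memLp_two_iff_integrable_sq (by fun_prop)).2 ?_
  have := ProbabilityTheory.integrable_pow_of_mem_interior_integrableExpSet
    h.zero_mem_interior_integrableExpSet (n * 2)
  simpa [pow_mul] using this

theorem HasExpMoment.memLp_eval {μ : Measure ℝ} (h : HasExpMoment μ) (p : ℝ[X]) :
    MemLp (fun x : ℝ => p.eval x) 2 μ := by
  simp_rw [Polynomial.eval_eq_sum_range]
  exact memLp_finsetSum _ fun i _ => (h.memLp_pow i).const_mul _

theorem HasExpMoment.integrable_eval_mul {μ : Measure ℝ} (h : HasExpMoment μ) (p : ℝ[X])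
    {F : ℝ → ℝ} (hF : MemLp F 2 μ) : Integrable (fun x : ℝ => p.eval x * F x) μ :=
  (h.memLp_eval p).integrable_mul hF

/-- Measures with square integrable density inherit exponential moments. -/
theorem HasExpMoment.withDensity {μ : Measure ℝ} (h : HasExpMoment μ) {F : ℝ → ℝ}
    (hF : MemLp F 2 μ) : HasExpMoment (μ.withDensity fun x => ENNReal.ofReal (F x)) := by
  obtain ⟨δ, hδ, hint⟩ := h
  refine ⟨δ / 2, by positivity, ?_⟩
  -- Halving `δ` makes the exponential square integrable, so Cauchy–Schwarz applies against `F`.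
  have hexp : MemLp (fun x : ℝ => Real.exp (δ / 2 * |x|)) 2 μ := by
    refine (memLp_two_iff_integrable_sq (by fun_prop)).2 (hint.congr (ae_of_all _ fun x => ?_))
    simp only [← Real.exp_nat_mul]
    congr 1
    push_cast
    ring
  refine (integrable_withDensity_iff_integrable_smul₀' hF.1.aemeasurable.ennreal_ofReal
    (ae_of_all _ fun x => ENNReal.ofReal_lt_top)).2 ?_
  simp_rw [ENNReal.toReal_ofReal', smul_eq_mul]
  exact hF.pos_part.integrable_mul hexp

theorem integral_withDensity_ofReal {μ : Measure ℝ} {F : ℝ → ℝ} (hF : AEMeasurable F μ)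
    (g : ℝ → ℝ) :
    ∫ x, g x ∂μ.withDensity (fun x => ENNReal.ofReal (F x)) = ∫ x, g x * max (F x) 0 ∂μ := by
  rw [integral_withDensity_eq_integral_toReal_smul₀ hF.ennreal_ofReal
    (ae_of_all _ fun x => ENNReal.ofReal_lt_top)]
  refine integral_congr_ae (ae_of_all _ fun x => ?_)
  simp only [ENNReal.toReal_ofReal', smul_eq_mul]
  ring

theorem HasExpMoment.integrable_pow {μ : Measure ℝ} (h : HasExpMoment μ) (n : ℕ) :
    Integrable (fun x : ℝ => x ^ n) μ := by
  simpa using ProbabilityTheory.integrable_pow_of_mem_interior_integrableExpSet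
    h.zero_mem_interior_integrableExpSet n

/-- If the moments of a signed measure `F dμ` with `F` square integrable are those of a positive
measure, then `F` is nonnegative. -/
theorem HasExpMoment.ae_nonneg_of_isMomentSequence {μ ζ : Measure ℝ} [IsFiniteMeasure μ]
    (h : HasExpMoment μ) {F : ℝ → ℝ} (hF : MemLp F 2 μ)
    (hζ : IsMomentSequence (fun n => ∫ x, x ^ n * F x ∂μ) ζ) : ∀ᵐ x ∂μ, 0 ≤ F x := by
  have hFm := hF.1.aemeasurable
  have hFi : Integrable F μ := hF.integrable (by norm_num)
  have hζfin : IsFiniteMeasure ζ := by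
    have := (hζ 0).1
    simp only [pow_zero] at this
    exact (integrable_const_iff_isFiniteMeasure one_ne_zero).1 this
  have hplus := h.withDensity hF
  have hminus := h.withDensity hF.neg
  have hfin₁ : IsFiniteMeasure (μ.withDensity fun x => ENNReal.ofReal (F x)) :=
    isFiniteMeasure_withDensity_ofReal hFi.2
  have hfin₂ : IsFiniteMeasure (μ.withDensity fun x => ENNReal.ofReal ((-F) x)) :=
    isFiniteMeasure_withDensity_ofReal hFi.neg.2
  have hpow : ∀ {G : ℝ → ℝ}, MemLp G 2 μ → ∀ n : ℕ, Integrable (fun x => x ^ n * max (G x) 0) μ :=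
    fun hG n => (h.memLp_pow n).integrable_mul hG.pos_part
  -- Moving `F⁻` to the side of `ζ` turns a signed identity of moments into one between positive
  -- measures.
  have heq : μ.withDensity (fun x => ENNReal.ofReal (F x)) =
      ζ + μ.withDensity fun x => ENNReal.ofReal ((-F) x) := by
    refine Measure.ext_of_moments_eq hplus.zero_mem_interior_integrableExpSet
      (fun n => (hζ n).1.add_measure (hminus.integrable_pow n)) fun n => ?_
    rw [integral_add_measure (hζ n).1 (hminus.integrable_pow n), (hζ n).2,
      integral_withDensity_ofReal hFm, integral_withDensity_ofReal hFm.neg,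
      ← integral_add (f := fun x => x ^ n * F x) ((h.memLp_pow n).integrable_mul hF)
        (hpow hF.neg n)]
    refine integral_congr_ae (ae_of_all _ fun x => ?_)
    simp only [Pi.neg_apply]
    rcases le_total 0 (F x) with hx | hx
    · rw [max_eq_left hx, max_eq_right (neg_nonpos.2 hx)]; ring
    · rw [max_eq_right hx, max_eq_left (neg_nonneg.2 hx)]; ring
  have hle : (fun x => ENNReal.ofReal ((-F) x)) ≤ᵐ[μ] fun x => ENNReal.ofReal (F x) := by
    refine ae_le_of_forall_setLIntegral_le_of_sigmaFinite₀ hFm.neg.ennreal_ofReal fun s hs _ => ?_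
    rw [← withDensity_apply _ hs, ← withDensity_apply _ hs, heq, Measure.add_apply]
    exact le_add_self
  filter_upwards [hle] with x hx
  by_contra! hneg
  rw [ENNReal.ofReal_of_nonpos hneg.le, nonpos_iff_eq_zero, ENNReal.ofReal_eq_zero] at hx
  simp only [Pi.neg_apply] at hx
  linarith

/-! ### Fourier coefficients of sections -/

theorem MeasureTheory.MemLp.ae_memLp_two_prodMk {μ ν : Measure ℝ} [SFinite μ] [SFinite ν]
    {f : ℝ × ℝ → ℝ} (hf : MemLp f 2 (μ.prod ν)) : ∀ᵐ x ∂μ, MemLp (fun y => f (x, y)) 2 ν := by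
  filter_upwards [hf.1.prodMk_left, hf.integrable_sq.prod_right_ae] with x h₁ h₂
  exact (memLp_two_iff_integrable_sq h₁).2 h₂

theorem lintegral_ofReal_sq_eq_eLpNorm_sq {Ω : Type*} [MeasurableSpace Ω] (ρ : Measure Ω)
    (f : Ω → ℝ) : ∫⁻ z, ENNReal.ofReal (f z ^ 2) ∂ρ = eLpNorm f 2 ρ ^ 2 := by
  have := eLpNorm_nnreal_pow_eq_lintegral (f := f) (μ := ρ) (p := 2) two_ne_zero
  simp only [NNReal.coe_ofNat, ENNReal.coe_ofNat, ENNReal.rpow_ofNat] at this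
  rw [this]
  refine lintegral_congr fun z => ?_
  rw [Real.enorm_eq_ofReal_abs, ← ENNReal.ofReal_pow (abs_nonneg _), sq_abs]

/-- Bessel's inequality for a single normalized function. -/
theorem sq_integral_mul_le {Ω : Type*} [MeasurableSpace Ω] {ρ : Measure Ω} {e g : Ω → ℝ}
    (he : MemLp e 2 ρ) (hg : MemLp g 2 ρ) (hone : ∫ y, e y * e y ∂ρ = 1) :
    (∫ y, e y * g y ∂ρ) ^ 2 ≤ ∫ y, g y ^ 2 ∂ρ := by
  set t := ∫ y, e y * g y ∂ρ with ht
  have heg : Integrable (fun y => e y * g y) ρ := he.integrable_mul hg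
  have hee : Integrable (fun y => e y * e y) ρ := he.integrable_mul he
  have h : 0 ≤ ∫ y, (g y - t * e y) ^ 2 ∂ρ := integral_nonneg fun y => sq_nonneg _
  have hexpand : ∫ y, (g y - t * e y) ^ 2 ∂ρ = ∫ y, g y ^ 2 ∂ρ - 2 * t * t + t ^ 2 * 1 := by
    have e₁ : ∀ y, (g y - t * e y) ^ 2 = g y ^ 2 - 2 * t * (e y * g y) + t ^ 2 * (e y * e y) :=
      fun y => by ring
    simp_rw [e₁]
    rw [integral_add (f := fun y => g y ^ 2 - 2 * t * (e y * g y))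
        (hg.integrable_sq.sub (heg.const_mul _)) (hee.const_mul _),
      integral_sub hg.integrable_sq (heg.const_mul _), integral_const_mul, integral_const_mul,
      hone, ← ht]
  nlinarith

theorem IsOrthonormalPolynomials.integral_mul_sum {ν : Measure ℝ} {β : ℕ → ℝ[X]}
    (hν : HasExpMoment ν) (hβ : IsOrthonormalPolynomials ν β) (d : ℕ → ℝ) {n N : ℕ} (hn : n < N) :
    ∫ y, (β n).eval y * ∑ k ∈ Finset.range N, d k * (β k).eval y ∂ν = d n := by
  simp_rw [Finset.mul_sum]
  rw [integral_finsetSum]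
  · have : ∀ k, ∫ y, (β n).eval y * (d k * (β k).eval y) ∂ν = if n = k then d k else 0 := fun k => by
      simp_rw [mul_left_comm _ (d k)]
      rw [integral_const_mul, hβ.integral_mul]
      split_ifs <;> simp
    simp_rw [this]
    simp [hn]
  · exact fun k _ => hν.integrable_eval_mul _ ((hν.memLp_eval _).const_mul _)

theorem memLp_two_eval_mul_eval {μ ν : Measure ℝ} [IsFiniteMeasure μ] [IsFiniteMeasure ν]
    (hμ : HasExpMoment μ) (hν : HasExpMoment ν) (p q : ℝ[X]) :
    MemLp (fun z : ℝ × ℝ => p.eval z.1 * q.eval z.2) 2 (μ.prod ν) := by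
  have hm : Continuous fun z : ℝ × ℝ => p.eval z.1 * q.eval z.2 := by fun_prop
  refine (memLp_two_iff_integrable_sq hm.aestronglyMeasurable).2 ?_
  simp_rw [mul_pow]
  exact (hμ.memLp_eval p).integrable_sq.mul_prod (hν.memLp_eval q).integrable_sq

theorem memLp_two_sum_eval_mul_eval {μ ν : Measure ℝ} [IsFiniteMeasure μ] [IsFiniteMeasure ν]
    (hμ : HasExpMoment μ) (hν : HasExpMoment ν) (α β : ℕ → ℝ[X]) (c : ℕ → ℝ) (N : ℕ) :
    MemLp (fun z : ℝ × ℝ => ∑ n ∈ Finset.range N, c n * (α n).eval z.1 * (β n).eval z.2) 2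
      (μ.prod ν) := by
  simp_rw [mul_assoc]
  exact memLp_finsetSum _ fun n _ => (memLp_two_eval_mul_eval hμ hν _ _).const_mul _

/-- The sections of a mean square sum of `c n * α n (x) * β n (y)` have Fourier coefficients
`c n * α n (x)`. -/
theorem ae_integral_eval_mul_section {μ ν : Measure ℝ} [IsFiniteMeasure μ] [IsFiniteMeasure ν]
    (hμ : HasExpMoment μ) (hν : HasExpMoment ν) {α β : ℕ → ℝ[X]}
    (hβ : IsOrthonormalPolynomials ν β) {c : ℕ → ℝ}
    {f : ℝ × ℝ → ℝ} (hf : MemLp f 2 (μ.prod ν))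
    (hlim : Tendsto (fun N : ℕ => eLpNorm (fun z : ℝ × ℝ =>
      (∑ n ∈ Finset.range N, c n * (α n).eval z.1 * (β n).eval z.2) - f z) 2 (μ.prod ν))
      atTop (𝓝 0)) (n : ℕ) :
    ∀ᵐ x ∂μ, ∫ y, (β n).eval y * f (x, y) ∂ν = c n * (α n).eval x := by
  set D : ℝ → ℝ := fun x => c n * (α n).eval x - ∫ y, (β n).eval y * f (x, y) ∂ν with hD
  have hDm : AEStronglyMeasurable D μ := by
    refine AEStronglyMeasurable.sub (by fun_prop) ?_
    have hc : Continuous fun z : ℝ × ℝ => (β n).eval z.2 := by fun_prop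
    exact (hc.aestronglyMeasurable.mul hf.1).integral_prod_right'
  -- For `n < N`, `D x` is the `n`-th coefficient of the section of the error. Bessel in `y`,
  -- integrated over `x`, bounds it by the full error.
  have hle : ∀ N, n < N → ∫⁻ x, ENNReal.ofReal (D x ^ 2) ∂μ ≤ eLpNorm (fun z : ℝ × ℝ =>
      (∑ n ∈ Finset.range N, c n * (α n).eval z.1 * (β n).eval z.2) - f z) 2 (μ.prod ν) ^ 2 := by
    intro N hN
    set g : ℝ × ℝ → ℝ := fun z =>
      (∑ n ∈ Finset.range N, c n * (α n).eval z.1 * (β n).eval z.2) - f z with hg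
    have hgm : MemLp g 2 (μ.prod ν) := (memLp_two_sum_eval_mul_eval hμ hν α β c N).sub hf
    rw [← lintegral_ofReal_sq_eq_eLpNorm_sq,
      lintegral_prod _ (hgm.1.aemeasurable.pow_const 2).ennreal_ofReal]
    refine lintegral_mono_ae ?_
    filter_upwards [hf.ae_memLp_two_prodMk, hgm.ae_memLp_two_prodMk] with x hfx hgx
    rw [← ofReal_integral_eq_lintegral_ofReal hgx.integrable_sq (ae_of_all _ fun y => sq_nonneg _)]
    refine ENNReal.ofReal_le_ofReal ?_
    have hDx : D x = ∫ y, (β n).eval y * g (x, y) ∂ν := by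
      simp only [hg, mul_sub]
      rw [integral_sub (hν.integrable_eval_mul _ (memLp_finsetSum _ fun k _ =>
        (hν.memLp_eval _).const_mul _)) (hν.integrable_eval_mul _ hfx),
        hβ.integral_mul_sum hν (fun k => c k * (α k).eval x) hN]
    rw [hDx]
    exact sq_integral_mul_le (hν.memLp_eval _) hgx (by simpa using hβ.integral_mul n n)
  have hzero : ∫⁻ x, ENNReal.ofReal (D x ^ 2) ∂μ = 0 := by
    refine le_antisymm (ge_of_tendsto (by simpa using ENNReal.Tendsto.pow (n := 2) hlim) ?_) zero_le
    filter_upwards [eventually_gt_atTop n] with N hN using hle N hN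
  rw [lintegral_eq_zero_iff' (hDm.aemeasurable.pow_const 2).ennreal_ofReal] at hzero
  filter_upwards [hzero] with x hx
  have : D x = 0 := by
    simp only [Pi.zero_apply, ENNReal.ofReal_eq_zero] at hx
    exact pow_eq_zero_iff two_ne_zero |>.1 (le_antisymm hx (sq_nonneg _))
  exact (sub_eq_zero.1 this).symm

/-! ### Mean square convergence as an orthonormal series -/

/-- The product functions `α n (x) * β n (y)` as elements of `L²(μ × ν)`. -/
noncomputable def productLp {μ ν : Measure ℝ} [IsFiniteMeasure μ] [IsFiniteMeasure ν]
    (hμ : HasExpMoment μ) (hν : HasExpMoment ν) (α β : ℕ → ℝ[X]) (n : ℕ) :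
    Lp ℝ 2 (μ.prod ν) :=
  (memLp_two_eval_mul_eval hμ hν (α n) (β n)).toLp

theorem orthonormal_productLp {μ ν : Measure ℝ} [IsFiniteMeasure μ] [IsFiniteMeasure ν]
    (hμ : HasExpMoment μ) (hν : HasExpMoment ν) {α β : ℕ → ℝ[X]}
    (hα : IsOrthonormalPolynomials μ α) (hβ : IsOrthonormalPolynomials ν β) :
    Orthonormal ℝ (productLp hμ hν α β) := by
  rw [orthonormal_iff_ite]
  intro i j
  rw [L2.inner_def]
  have : ∀ᵐ z ∂μ.prod ν, inner ℝ (productLp hμ hν α β i z) (productLp hμ hν α β j z) =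
      ((α i).eval z.1 * (α j).eval z.1) * ((β i).eval z.2 * (β j).eval z.2) := by
    filter_upwards [(memLp_two_eval_mul_eval hμ hν (α i) (β i)).coeFn_toLp,
      (memLp_two_eval_mul_eval hμ hν (α j) (β j)).coeFn_toLp] with z h₁ h₂
    simp only [productLp]
    rw [h₁, h₂, real_inner_eq_re_inner]
    simp only [RCLike.inner_apply, conj_trivial, RCLike.re_to_real]
    ring
  rw [integral_congr_ae this, integral_prod_mul (fun x => (α i).eval x * (α j).eval x)
    fun y => (β i).eval y * (β j).eval y, hα.integral_mul, hβ.integral_mul]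
  split_ifs <;> simp

theorem Orthonormal.summable_smul_iff {ι E : Type*} [NormedAddCommGroup E] [InnerProductSpace ℝ E]
    [CompleteSpace E] {v : ι → E} (hv : Orthonormal ℝ v) (c : ι → ℝ) :
    Summable (fun i => c i • v i) ↔ Summable fun i => c i ^ 2 := by
  have := hv.orthogonalFamily.summable_iff_norm_sq_summable c
  simpa using this

theorem sum_smul_productLp_eq_toLp {μ ν : Measure ℝ} [IsFiniteMeasure μ] [IsFiniteMeasure ν]
    (hμ : HasExpMoment μ) (hν : HasExpMoment ν) (α β : ℕ → ℝ[X]) (c : ℕ → ℝ) (N : ℕ) :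
    ∑ n ∈ Finset.range N, c n • productLp hμ hν α β n =
      (memLp_two_sum_eval_mul_eval hμ hν α β c N).toLp := by
  induction N with
  | zero =>
    refine (MemLp.toLp_zero (MemLp.zero' (p := 2) (μ := μ.prod ν) (ε := ℝ))).symm.trans ?_
    exact MemLp.toLp_congr _ _ (ae_of_all _ fun z => by simp)
  | succ N ih =>
    rw [Finset.sum_range_succ, ih, productLp, ← MemLp.toLp_const_smul, ← MemLp.toLp_add]
    refine MemLp.toLp_congr _ _ (ae_of_all _ fun z => ?_)
    simp [Finset.sum_range_succ, mul_assoc]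

theorem tendsto_eLpNorm_sum_iff {μ ν : Measure ℝ} [IsFiniteMeasure μ] [IsFiniteMeasure ν]
    (hμ : HasExpMoment μ) (hν : HasExpMoment ν) {α β : ℕ → ℝ[X]} {c : ℕ → ℝ}
    {f : ℝ × ℝ → ℝ} (hf : MemLp f 2 (μ.prod ν)) :
    Tendsto (fun N : ℕ => eLpNorm (fun z : ℝ × ℝ =>
      (∑ n ∈ Finset.range N, c n * (α n).eval z.1 * (β n).eval z.2) - f z) 2 (μ.prod ν))
      atTop (𝓝 0) ↔
    Tendsto (fun N => ∑ n ∈ Finset.range N, c n • productLp hμ hν α β n) atTop (𝓝 hf.toLp) := by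
  simp_rw [sum_smul_productLp_eq_toLp]
  exact (Lp.tendsto_Lp_iff_tendsto_eLpNorm'' _
    (fun N => memLp_two_sum_eval_mul_eval hμ hν α β c N) f hf).symm

theorem exists_tendsto_eLpNorm_sum {μ ν : Measure ℝ} [IsFiniteMeasure μ] [IsFiniteMeasure ν]
    (hμ : HasExpMoment μ) (hν : HasExpMoment ν) {α β : ℕ → ℝ[X]}
    (hα : IsOrthonormalPolynomials μ α) (hβ : IsOrthonormalPolynomials ν β) {c : ℕ → ℝ}
    (hc : Summable fun n => c n ^ 2) :
    ∃ f : ℝ × ℝ → ℝ, MemLp f 2 (μ.prod ν) ∧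
      Tendsto (fun N : ℕ => eLpNorm (fun z : ℝ × ℝ =>
        (∑ n ∈ Finset.range N, c n * (α n).eval z.1 * (β n).eval z.2) - f z) 2 (μ.prod ν))
        atTop (𝓝 0) := by
  obtain ⟨F, hF⟩ := ((orthonormal_productLp hμ hν hα hβ).summable_smul_iff c).2 hc
  refine ⟨F, Lp.memLp F, (tendsto_eLpNorm_sum_iff hμ hν (Lp.memLp F)).2 ?_⟩
  rw [Lp.toLp_coeFn]
  exact hF.tendsto_sum_nat

/-- By continuity of the inner product, `c n` is the `n`-th coefficient of the limit; then Bessel.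
-/
theorem summable_sq_of_tendsto_eLpNorm_sum {μ ν : Measure ℝ} [IsFiniteMeasure μ]
    [IsFiniteMeasure ν] (hμ : HasExpMoment μ) (hν : HasExpMoment ν) {α β : ℕ → ℝ[X]}
    (hα : IsOrthonormalPolynomials μ α) (hβ : IsOrthonormalPolynomials ν β) {c : ℕ → ℝ}
    {f : ℝ × ℝ → ℝ} (hf : MemLp f 2 (μ.prod ν))
    (hlim : Tendsto (fun N : ℕ => eLpNorm (fun z : ℝ × ℝ =>
      (∑ n ∈ Finset.range N, c n * (α n).eval z.1 * (β n).eval z.2) - f z) 2 (μ.prod ν))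
      atTop (𝓝 0)) : Summable fun n => c n ^ 2 := by
  have horth := orthonormal_productLp hμ hν hα hβ
  have hlim' := (tendsto_eLpNorm_sum_iff hμ hν hf).1 hlim
  have hcoef : ∀ n, inner ℝ (productLp hμ hν α β n) hf.toLp = c n := fun n => by
    refine tendsto_nhds_unique (tendsto_const_nhds.inner hlim')
      (tendsto_const_nhds.congr' ?_)
    filter_upwards [eventually_gt_atTop n] with N hN
    exact (horth.inner_right_sum c (Finset.mem_range.2 hN)).symm
  simpa [hcoef] using horth.inner_products_summable hf.toLp

theorem tendsto_eLpNorm_sum_swap {μ ν : Measure ℝ} [IsFiniteMeasure μ] [IsFiniteMeasure ν]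
    {α β : ℕ → ℝ[X]} {c : ℕ → ℝ} {f : ℝ × ℝ → ℝ} (hf : MemLp f 2 (μ.prod ν))
    (hlim : Tendsto (fun N : ℕ => eLpNorm (fun z : ℝ × ℝ =>
      (∑ n ∈ Finset.range N, c n * (α n).eval z.1 * (β n).eval z.2) - f z) 2 (μ.prod ν))
      atTop (𝓝 0)) :
    Tendsto (fun N : ℕ => eLpNorm (fun z : ℝ × ℝ =>
      (∑ n ∈ Finset.range N, c n * (β n).eval z.1 * (α n).eval z.2) - f z.swap) 2 (ν.prod μ))
      atTop (𝓝 0) := by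
  refine hlim.congr fun N => ?_
  have hc : Continuous fun z : ℝ × ℝ =>
      ∑ n ∈ Finset.range N, c n * (α n).eval z.1 * (β n).eval z.2 := by fun_prop
  refine (eLpNorm_comp_measurePreserving (hc.aestronglyMeasurable.sub hf.1)
    (Measure.measurePreserving_swap (μ := ν) (ν := μ))).symm.trans ?_
  congr 1
  funext z
  simp [mul_right_comm]

/-! ### Linear functionals on polynomials and moment families -/

/-- Orthonormal polynomials form a basis of the space of polynomials. -/
noncomputable def IsOrthonormalPolynomials.basis {μ : Measure ℝ} {α : ℕ → ℝ[X]}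
    (hα : IsOrthonormalPolynomials μ α) : Module.Basis ℕ ℝ ℝ[X] :=
  Polynomial.Sequence.basis ⟨α, hα.degree_eq⟩ fun n => by
    refine isUnit_iff_ne_zero.2 (leadingCoeff_ne_zero.2 fun h => ?_)
    have := hα.degree_eq n
    rw [show α n = 0 from h, degree_zero] at this
    exact WithBot.coe_ne_bot this.symm

@[simp]
theorem IsOrthonormalPolynomials.basis_apply {μ : Measure ℝ} {α : ℕ → ℝ[X]}
    (hα : IsOrthonormalPolynomials μ α) (n : ℕ) : hα.basis n = α n := by
  simp [IsOrthonormalPolynomials.basis]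

theorem IsOrthonormalPolynomials.eq_sum {μ : Measure ℝ} {α : ℕ → ℝ[X]}
    (hα : IsOrthonormalPolynomials μ α) (n : ℕ) :
    α n = ∑ j ∈ Finset.range (n + 1), (α n).coeff j • (X : ℝ[X]) ^ j := by
  have := (α n).as_sum_range_C_mul_X_pow' (n := n + 1)
    (by rw [natDegree_eq_of_degree_eq_some (hα.degree_eq n)]; exact n.lt_succ_self)
  simpa only [← smul_eq_C_mul] using this

/-- Integration of polynomials against an integrable weight, as a linear functional. -/
noncomputable def integralEvalMul (ρ : Measure ℝ) (F : ℝ → ℝ)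
    (h : ∀ p : ℝ[X], Integrable (fun x => p.eval x * F x) ρ) : ℝ[X] →ₗ[ℝ] ℝ where
  toFun p := ∫ x, p.eval x * F x ∂ρ
  map_add' p q := by
    simp only [eval_add, add_mul]
    exact integral_add (h p) (h q)
  map_smul' r p := by
    simp only [eval_smul, smul_eq_mul, mul_assoc, RingHom.id_apply]
    exact integral_const_mul _ _

theorem integralEvalMul_apply {ρ : Measure ℝ} {F : ℝ → ℝ}
    (h : ∀ p : ℝ[X], Integrable (fun x => p.eval x * F x) ρ) (p : ℝ[X]) :
    integralEvalMul ρ F h p = ∫ x, p.eval x * F x ∂ρ := rfl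

/-- The linear map sending `α n` to `c n • β n`. -/
noncomputable def momentMap {μ : Measure ℝ} {α : ℕ → ℝ[X]} (hα : IsOrthonormalPolynomials μ α)
    (β : ℕ → ℝ[X]) (c : ℕ → ℝ) : ℝ[X] →ₗ[ℝ] ℝ[X] :=
  hα.basis.constr ℝ fun n => c n • β n

theorem momentMap_apply {μ : Measure ℝ} {α : ℕ → ℝ[X]} (hα : IsOrthonormalPolynomials μ α)
    (β : ℕ → ℝ[X]) (c : ℕ → ℝ) (n : ℕ) : momentMap hα β c (α n) = c n • β n := by
  have := hα.basis.constr_basis ℝ (fun n => c n • β n) n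
  rwa [hα.basis_apply] at this

theorem sum_coeff_mul_eval_momentMap {μ : Measure ℝ} {α : ℕ → ℝ[X]}
    (hα : IsOrthonormalPolynomials μ α) (β : ℕ → ℝ[X]) (c : ℕ → ℝ) (y : ℝ) (n : ℕ) :
    ∑ j ∈ Finset.range (n + 1), (α n).coeff j * (momentMap hα β c (X ^ j)).eval y =
      c n * (β n).eval y := by
  have := congrArg (fun p => (momentMap hα β c p).eval y) (hα.eq_sum n)
  simp only [map_sum, map_smul, momentMap_apply, eval_finsetSum, eval_smul, smul_eq_mul] at this
  exact this.symm

theorem isMomentSequence_withDensity {μ : Measure ℝ} (hμ : HasExpMoment μ) {F : ℝ → ℝ}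
    (hF : MemLp F 2 μ) (hpos : ∀ᵐ x ∂μ, 0 ≤ F x) :
    IsMomentSequence (fun n => ∫ x, x ^ n * F x ∂μ)
      (μ.withDensity fun x => ENNReal.ofReal (F x)) := fun n => by
  refine ⟨(hμ.withDensity hF).integrable_pow n, ?_⟩
  rw [integral_withDensity_ofReal hF.1.aemeasurable]
  refine integral_congr_ae ?_
  filter_upwards [hpos] with x hx
  rw [max_eq_left hx]

theorem integral_eval_mul_eq_eval_momentMap {μ : Measure ℝ} (hμ : HasExpMoment μ)
    {α β : ℕ → ℝ[X]} (hα : IsOrthonormalPolynomials μ α) {c : ℕ → ℝ} {F : ℝ → ℝ}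
    (hF : MemLp F 2 μ) {y : ℝ} (hcoef : ∀ n, ∫ x, (α n).eval x * F x ∂μ = c n * (β n).eval y)
    (p : ℝ[X]) : ∫ x, p.eval x * F x ∂μ = (momentMap hα β c p).eval y := by
  have : integralEvalMul μ F (fun p => hμ.integrable_eval_mul p hF) =
      (Polynomial.leval y).comp (momentMap hα β c) := by
    refine hα.basis.ext fun n => ?_
    simp [integralEvalMul_apply, hcoef, momentMap_apply]
  exact LinearMap.congr_fun this p

/-- The representing measures are `f (y, ·) dμ`, with `y` as first coordinate. -/
theorem isPolynomialMomentFamily_momentMap {μ ν : Measure ℝ} [IsFiniteMeasure μ]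
    [IsFiniteMeasure ν] (hμ : HasExpMoment μ) (hν : HasExpMoment ν) {α β : ℕ → ℝ[X]}
    (hα : IsOrthonormalPolynomials μ α) {c : ℕ → ℝ}
    {f : ℝ × ℝ → ℝ} (hf : MemLp f 2 (ν.prod μ)) (hpos : ∀ᵐ z ∂ν.prod μ, 0 ≤ f z)
    (hlim : Tendsto (fun N : ℕ => eLpNorm (fun z : ℝ × ℝ =>
      (∑ n ∈ Finset.range N, c n * (β n).eval z.1 * (α n).eval z.2) - f z) 2 (ν.prod μ))
      atTop (𝓝 0)) :
    IsPolynomialMomentFamily μ ν fun n => momentMap hα β c (X ^ n) := by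
  refine ⟨fun y => μ.withDensity fun x => ENNReal.ofReal (f (y, x)), ?_⟩
  filter_upwards [hf.ae_memLp_two_prodMk, Measure.ae_ae_of_ae_prod hpos,
    ae_all_iff.2 fun n => ae_integral_eval_mul_section hν hμ hα hf hlim n] with y hfy hposy hcoef
  refine ⟨withDensity_absolutelyContinuous _ _, ?_⟩
  convert isMomentSequence_withDensity hμ hfy hposy using 2 with n
  have := integral_eval_mul_eq_eval_momentMap hμ hα hfy hcoef (X ^ n)
  simpa using this.symm

/-- Integration against `F dμ` and against `ζ` are linear functionals agreeing on the basis `α n`,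
hence on monomials. -/
theorem integral_pow_mul_eq_of_isMomentSequence {μ ζ : Measure ℝ} (hμ : HasExpMoment μ)
    {α : ℕ → ℝ[X]} (hα : IsOrthonormalPolynomials μ α) {F : ℝ → ℝ} (hF : MemLp F 2 μ)
    {m : ℕ → ℝ} (hζ : IsMomentSequence m ζ)
    (hcoef : ∀ n, ∑ j ∈ Finset.range (n + 1), (α n).coeff j * m j = ∫ x, (α n).eval x * F x ∂μ)
    (n : ℕ) : ∫ x, x ^ n * F x ∂μ = m n := by
  have hint : ∀ p : ℝ[X], Integrable (fun x => p.eval x * 1) ζ := fun p => by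
    simp_rw [mul_one, Polynomial.eval_eq_sum_range]
    exact integrable_finsetSum _ fun i _ => (hζ i).1.const_mul _
  have hpow : ∀ j, integralEvalMul ζ (fun _ => 1) hint (X ^ j) = m j := fun j => by
    simpa [integralEvalMul_apply] using (hζ j).2
  have : integralEvalMul μ F (fun p => hμ.integrable_eval_mul p hF) =
      integralEvalMul ζ (fun _ => 1) hint := by
    refine hα.basis.ext fun n => ?_
    rw [hα.basis_apply, integralEvalMul_apply, ← hcoef n]
    conv_rhs => rw [hα.eq_sum n]
    simp [hpow]
  have h := LinearMap.congr_fun this (X ^ n)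
  rw [hpow] at h
  simpa [integralEvalMul_apply] using h

theorem ae_nonneg_of_isPolynomialMomentFamily {μ ν : Measure ℝ} [IsFiniteMeasure μ]
    [IsFiniteMeasure ν] (hμ : HasExpMoment μ) (hν : HasExpMoment ν) {α β : ℕ → ℝ[X]}
    (hα : IsOrthonormalPolynomials μ α) {c : ℕ → ℝ}
    {f : ℝ × ℝ → ℝ} (hf : MemLp f 2 (ν.prod μ))
    (hlim : Tendsto (fun N : ℕ => eLpNorm (fun z : ℝ × ℝ =>
      (∑ n ∈ Finset.range N, c n * (β n).eval z.1 * (α n).eval z.2) - f z) 2 (ν.prod μ))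
      atTop (𝓝 0)) {m : ℕ → ℝ[X]} (hm : IsPolynomialMomentFamily μ ν m)
    (hcoef : ∀ᵐ y ∂ν, ∀ n : ℕ,
      ∑ j ∈ Finset.range (n + 1), (α n).coeff j * (m j).eval y = c n * (β n).eval y) :
    ∀ᵐ z ∂ν.prod μ, 0 ≤ f z := by
  obtain ⟨ζ, hζ⟩ := hm
  have hsec : ∀ᵐ y ∂ν, ∀ᵐ x ∂μ, 0 ≤ f (y, x) := by
    filter_upwards [hζ, hcoef, hf.ae_memLp_two_prodMk,
      ae_all_iff.2 fun n => ae_integral_eval_mul_section hν hμ hα hf hlim n] with y hζy hcy hfy hy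
    refine hμ.ae_nonneg_of_isMomentSequence hfy (ζ := ζ y) ?_
    simp_rw [integral_pow_mul_eq_of_isMomentSequence hμ hα hfy hζy.2
      fun n => (hcy n).trans (hy n).symm]
    exact hζy.2
  -- Passing from almost all sections to the product needs a measurable set, hence the measurable
  -- representative of `f`.
  have hmk : ∀ᵐ z ∂ν.prod μ, 0 ≤ hf.1.mk f z := by
    rw [Measure.ae_prod_iff_ae_ae
      (measurableSet_le measurable_const hf.1.stronglyMeasurable_mk.measurable)]
    filter_upwards [hsec, Measure.ae_ae_of_ae_prod hf.1.ae_eq_mk] with y h₁ h₂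
    filter_upwards [h₁, h₂] with x h₃ h₄
    rwa [← h₄]
  filter_upwards [hmk, hf.1.ae_eq_mk] with z h₁ h₂
  rwa [h₂]

theorem theorem4 (μ ν : Measure ℝ) [IsFiniteMeasure μ] [IsFiniteMeasure ν]
    (hμ : HasExpMoment μ) (hν : HasExpMoment ν)
    (α β : ℕ → ℝ[X])
    (hα : IsOrthonormalPolynomials μ α) (hβ : IsOrthonormalPolynomials ν β)
    (c : ℕ → ℝ) :
    ConvergesToNonneg μ ν α β c ↔
      (Summable fun n => c n ^ 2) ∧
      ∃ ma mb : ℕ → ℝ[X],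
        IsPolynomialMomentFamily μ ν ma ∧
        IsPolynomialMomentFamily ν μ mb ∧
        (∀ᵐ y ∂ν, ∀ n : ℕ,
          ∑ j ∈ Finset.range (n + 1), (α n).coeff j * (ma j).eval y = c n * (β n).eval y) ∧
        (∀ᵐ x ∂μ, ∀ n : ℕ,
          ∑ j ∈ Finset.range (n + 1), (β n).coeff j * (mb j).eval x = c n * (α n).eval x) := by
  constructor
  · rintro ⟨f, hf, hpos, hlim⟩
    have hswap : MemLp (fun z : ℝ × ℝ => f z.swap) 2 (ν.prod μ) :=
      hf.comp_measurePreserving Measure.measurePreserving_swap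
    have hpos' : ∀ᵐ z : ℝ × ℝ ∂ν.prod μ, 0 ≤ f z.swap :=
      (Measure.measurePreserving_swap (μ := ν) (ν := μ)).quasiMeasurePreserving.ae hpos
    exact ⟨summable_sq_of_tendsto_eLpNorm_sum hμ hν hα hβ hf hlim,
      fun n => momentMap hα β c (X ^ n), fun n => momentMap hβ α c (X ^ n),
      isPolynomialMomentFamily_momentMap hμ hν hα hswap hpos' (tendsto_eLpNorm_sum_swap hf hlim),
      isPolynomialMomentFamily_momentMap hν hμ hβ hf hpos hlim,
      ae_of_all _ fun y n => sum_coeff_mul_eval_momentMap hα β c y n,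
      ae_of_all _ fun x n => sum_coeff_mul_eval_momentMap hβ α c x n⟩
  -- Nonnegativity of almost every section `f (x, ·)` already gives that of `f`, so one family is
  -- enough.
  · rintro ⟨hc, -, mb, -, hmb, -, hcoef⟩
    obtain ⟨f, hf, hlim⟩ := exists_tendsto_eLpNorm_sum hμ hν hα hβ hc
    exact ⟨f, hf, ae_nonneg_of_isPolynomialMomentFamily hν hμ hβ hf hlim hmb hcoef, hlim⟩
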